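/- Let $E=\mathbb C/(\mathbb Z+\tau\mathbb Z)$, $\operatorname{im}\tau>0$, be a complex elliptic curve and let $E^3$ carry the product polarization $p_1^*(m\Theta)+p_2^*(n\Theta)+p_3^*(p\Theta)$, where $m,n,p$ are positive integers, $p_1,p_2,p_3:E^3\to E$ are the projections and $\Theta$ is the principal polarization of $E$. By an elliptic curve in $E^3$ we mean a one-dimensional complex subtorus, and its degree is the degree of the induced polarization on it. For every integer $t\ge 0$ the set of elliptic curves in $E^3$ of degree at most $t$ is finite; let $N_{E^3}(t)$ be its cardinality. Then there are a constant $C$ and a function $q$ with $q(t)=O(t^4)$ for $t\to\infty$ such that $$N_{E^3}(t)\le C\,t^5+q(t)\qquad\text{for every integer } t\ge 0,$$ and both can be given explicitly, as follows. Put $\mu=\min\{m,n,p\}$. (CM case) Suppose that $E$ has complex multiplication, so that $w\tau^2+u\tau+v=0$ for coprime integers $u,v,w$ with $w>0$. Let $A=\pi\,(vw-u^2/4)^{-1/2}$ be the area of the region $x^2+uxy+vwy^2\le 1$ in $\mathbb R^2$. Then one can take $$C=\frac{A^2}{3\,\mu^2\,mnp}$$ (that is, $C=\frac{A^2}{3m^3np}$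 when $m\le n\le p$) and, with $s=t/\mu$, $r=\mu t^2/(mnp)$, $B=2+2A/\pi$, $$q(t)=\frac{A s^3}{3}\bigl(B\sqrt r+1\bigr)+2\Bigl(\frac{\pi}{8}B s^2+2s\Bigr)\bigl(A r+B\sqrt r+1\bigr).$$ (No CM) If $E$ has no complex multiplication, one can take $C=0$ and $$q(t)=\bigl(2\sqrt{t/m}+1\bigr)\bigl(2\sqrt{t/n}+1\bigr)\bigl(2\sqrt{t/p}+1\bigr).$$ -/

import Mathlib

open Filter Asymptotics
open scoped UpperHalfPlane

noncomputable section

namespace SelfProduct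

/-- The period lattice `ℤ + τ ℤ` in `ℂ`. -/
def lattice (τ : ℍ) : AddSubgroup ℂ := AddSubgroup.closure {1, (τ : ℂ)}

/-- The elliptic curve `E = ℂ / (ℤ + τ ℤ)`. -/
abbrev Curve (τ : ℍ) : Type := ℂ ⧸ lattice τ

/-- `E` has complex multiplication: its endomorphism ring `{z ∈ ℂ | z Λ ⊆ Λ}`, `Λ = ℤ + τ ℤ`,
is larger than `ℤ`. -/
def HasCM (τ : ℍ) : Prop :=
  ∃ z : ℂ, (∀ k : ℤ, z ≠ k) ∧ ∀ x ∈ lattice τ, z * x ∈ lattice τ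

/-- The universal covering `ℂ^g → E^g`. -/
def cover (τ : ℍ) (g : ℕ) : (Fin g → ℂ) →+ (Fin g → Curve τ) :=
  (QuotientAddGroup.mk' (lattice τ)).compLeft (Fin g)

/-- The period lattice of `E^g`, namely `ℤ^g + τ ℤ^g`. -/
def periods (τ : ℍ) (g : ℕ) : AddSubgroup (Fin g → ℂ) := (cover τ g).ker

/-- `S` is an elliptic curve in `E^g`, that is, a one-dimensional complex subtorus: the image
of a complex line `L` of `ℂ^g` which meets the period lattice in a subgroup of rank two
(so that `S = L / (L ∩ Λ)`). -/
def IsEllipticCurve (τ : ℍ) (g : ℕ) (S : AddSubgroup (Fin g → Curve τ)) : Prop :=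
  ∃ L : Submodule ℂ (Fin g → ℂ), Module.finrank ℂ L = 1 ∧
    Module.finrank ℤ (L.toAddSubgroup ⊓ periods τ g : AddSubgroup (Fin g → ℂ)) = 2 ∧
    S = L.toAddSubgroup.map (cover τ g)

/-- The first homology group `H₁(S, ℤ)`, seen inside the period lattice `H₁(E^g, ℤ)`: the
periods `l` such that the loop `x ↦ x l` runs in `S`. -/
def homology (τ : ℍ) (g : ℕ) (S : AddSubgroup (Fin g → Curve τ)) :
    AddSubgroup (Fin g → ℂ) where
  carrier := {l | l ∈ periods τ g ∧ ∀ x : ℝ, cover τ g (x • l) ∈ S}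
  zero_mem' := ⟨zero_mem _, fun x => by simp⟩
  add_mem' := fun {a b} ha hb =>
    ⟨add_mem ha.1 hb.1, fun x => by
      rw [smul_add, map_add]; exact add_mem (ha.2 x) (hb.2 x)⟩
  neg_mem' := fun {a} ha =>
    ⟨neg_mem ha.1, fun x => by rw [smul_neg, map_neg]; exact neg_mem (ha.2 x)⟩

/-- The Hermitian form of the product polarization `p₁^*(m₁Θ) + ⋯ + p_g^*(m_gΘ)` on `E^g`, where
`Θ` is the principal polarization of `E`, whose Hermitian form is `z conj(w) / im τ`. -/
def hermitianForm (τ : ℍ) {g : ℕ} (m : Fin g → ℕ) (z w : Fin g → ℂ) : ℂ :=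
  ∑ i, (m i : ℂ) * (z i * (starRingEnd ℂ) (w i) / (τ.im : ℂ))

/-- The alternating form of the product polarization (its first Chern class), the imaginary
part of the Hermitian form. -/
def polarization (τ : ℍ) {g : ℕ} (m : Fin g → ℕ) (z w : Fin g → ℂ) : ℝ :=
  (hermitianForm τ m z w).im

open Classical in
/-- The degree of an elliptic curve `S` with respect to the product polarization: the degree of
the induced polarization on `S`, i.e. the absolute value of the alternating form on a basis
of `H₁(S, ℤ)`. It does not depend on the basis, by `degree_eq` below. -/
def degree (τ : ℍ) {g : ℕ} (m : Fin g → ℕ) (S : AddSubgroup (Fin g → Curve τ)) : ℝ :=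
  if h : ∃ b : (Fin g → ℂ) × (Fin g → ℂ), AddSubgroup.closure {b.1, b.2} = homology τ g S then
    |polarization τ m h.choose.1 h.choose.2|
  else 0

lemma polarization_comb (τ : ℍ) {g : ℕ} (m : Fin g → ℕ) (x y : Fin g → ℂ) (a b c d : ℤ) :
    polarization τ m (a • x + b • y) (c • x + d • y)
      = ((a * d - b * c : ℤ) : ℝ) * polarization τ m x y := by
  simp only [polarization, hermitianForm, Complex.im_sum, Finset.mul_sum]
  refine Finset.sum_congr rfl fun i _ => ?_
  simp only [← Complex.ofReal_natCast, Complex.im_ofReal_mul, Complex.div_ofReal_im]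
  simp only [Pi.add_apply, Pi.smul_apply]
  simp only [zsmul_eq_mul, map_add, map_mul, map_intCast,
    Complex.mul_im, Complex.add_re, Complex.add_im, Complex.mul_re, Complex.intCast_re,
    Complex.intCast_im, Complex.conj_re, Complex.conj_im]
  push_cast
  ring

lemma abs_polarization_eq (τ : ℍ) {g : ℕ} (m : Fin g → ℕ) (x y x' y' : Fin g → ℂ)
    (h : AddSubgroup.closure {x, y} = AddSubgroup.closure {x', y'}) :
    |polarization τ m x y| = |polarization τ m x' y'| := by
  have key : ∀ x y x' y' : Fin g → ℂ,
      AddSubgroup.closure {x, y} = AddSubgroup.closure {x', y'} →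
      |polarization τ m x y| ≤ |polarization τ m x' y'| ∨ polarization τ m x' y' = 0 := by
    intro x y x' y' h
    have hx : x' ∈ AddSubgroup.closure {x, y} := h ▸ AddSubgroup.subset_closure (by simp)
    have hy : y' ∈ AddSubgroup.closure {x, y} := h ▸ AddSubgroup.subset_closure (by simp)
    obtain ⟨a, b, rfl⟩ := AddSubgroup.mem_closure_pair.1 hx
    obtain ⟨c, d, rfl⟩ := AddSubgroup.mem_closure_pair.1 hy
    rw [polarization_comb]
    by_cases h0 : a * d - b * c = 0
    · right; simp [h0]
    · left
      have h1 : (1 : ℝ) ≤ |((a * d - b * c : ℤ) : ℝ)| := by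
        exact_mod_cast Int.one_le_abs h0
      rw [abs_mul]
      nlinarith [abs_nonneg (polarization τ m x y)]
  have zero : ∀ x y x' y' : Fin g → ℂ,
      AddSubgroup.closure {x, y} = AddSubgroup.closure {x', y'} →
      polarization τ m x y = 0 → polarization τ m x' y' = 0 := by
    intro x y x' y' h h0
    have hx : x' ∈ AddSubgroup.closure {x, y} := h ▸ AddSubgroup.subset_closure (by simp)
    have hy : y' ∈ AddSubgroup.closure {x, y} := h ▸ AddSubgroup.subset_closure (by simp)
    obtain ⟨a, b, rfl⟩ := AddSubgroup.mem_closure_pair.1 hx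
    obtain ⟨c, d, rfl⟩ := AddSubgroup.mem_closure_pair.1 hy
    rw [polarization_comb, h0, mul_zero]
  rcases key x y x' y' h with h1 | h1
  · rcases key x' y' x y h.symm with h2 | h2
    · exact le_antisymm h1 h2
    · rw [h2, zero x y x' y' h h2]
  · rw [h1, zero x' y' x y h.symm h1]

/-- The degree may be computed in every basis of `H₁(S, ℤ)`. -/
lemma degree_eq (τ : ℍ) {g : ℕ} (m : Fin g → ℕ) (S : AddSubgroup (Fin g → Curve τ))
    (x y : Fin g → ℂ) (h : AddSubgroup.closure {x, y} = homology τ g S) :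
    degree τ m S = |polarization τ m x y| := by
  have h' : ∃ b : (Fin g → ℂ) × (Fin g → ℂ),
      AddSubgroup.closure {b.1, b.2} = homology τ g S := ⟨(x, y), h⟩
  rw [degree, dif_pos h']
  exact abs_polarization_eq τ m _ _ _ _ (h'.choose_spec.trans h.symm)

/-- The elliptic curves in `E^g` of degree at most `t` with respect to the product polarization. -/
def curvesOfDegreeLE (τ : ℍ) {g : ℕ} (m : Fin g → ℕ) (t : ℕ) :
    Set (AddSubgroup (Fin g → Curve τ)) :=
  {S | IsEllipticCurve τ g S ∧ degree τ m S ≤ t}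

/-- The counting function `N_{E^g}(t)`. -/
def countCurves (τ : ℍ) {g : ℕ} (m : Fin g → ℕ) (t : ℕ) : ℕ :=
  (curvesOfDegreeLE τ m t).ncard

/-- The area `π (vw - u²/4)^{-1/2}` of the region `x² + u x y + v w y² ≤ 1` in the plane. -/
def ellipseArea (u v w : ℤ) : ℝ := Real.pi / Real.sqrt ((v : ℝ) * w - (u : ℝ) ^ 2 / 4)

/-- The leading constant; it is `A² / (3 m³ n p)` when `m ≤ n ≤ p`. -/
def leadingConstant (A : ℝ) (m n p : ℕ) : ℝ :=
  A ^ 2 / (3 * (min m (min n p) : ℕ) ^ 2 * (m * n * p))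

/-- An explicit function of order `t⁴`. With `s = t / m`, `r = t² / (n p)` when `m ≤ n ≤ p`, and
with `B = 2 + 2 A / π`, adding the leading term `A s³ / 3 * (A r)` to it gives
`2 (A s³ / 6 + π B s² / 8 + 2 s) (A r + B √r + 1)`. -/
def remainderCM (A : ℝ) (m n p t : ℕ) : ℝ :=
  let k : ℝ := (min m (min n p) : ℕ)
  let s : ℝ := t / k
  let r : ℝ := k * t ^ 2 / (m * n * p)
  let B : ℝ := 2 + 2 * A / Real.pi
  A * s ^ 3 / 3 * (B * Real.sqrt r + 1)
    + 2 * (Real.pi * B * s ^ 2 / 8 + 2 * s) * (A * r + B * Real.sqrt r + 1)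

/-- An explicit function of order `t^{3/2}`. -/
def remainderNonCM (m n p t : ℕ) : ℝ :=
  (2 * Real.sqrt (t / m) + 1) * (2 * Real.sqrt (t / n) + 1) * (2 * Real.sqrt (t / p) + 1)

end SelfProduct

end

namespace SelfProduct

/-! An elliptic curve `S` is the image of a line spanned by some `l`. If `l j ≠ 0`, the `j`-th
projection maps `S` to `E` by an isogeny of some degree `k`. Rescaling `l` so that its `j`-th entry
is `k` turns all entries into endomorphisms `α i` of `E`, and `k * deg S = ∑ m i * |α i|²`
(`exists_multipliers_of_pos`). So curves are counted by counting such vectors.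

If `deg S ≤ t`, the term `m j * k²` gives `k ≤ t / m j`, and completing the square in `k` gives `|α
i|² ≤ t² / (4 * m i * m j)`. With complex multiplication `End E = ℤ + ℤ wτ` is a plane lattice, so
for sorted weights the number of vectors is at most about `s * (A s² / π) * (A r / π)`, of order
`t⁵`; since `π² > 3` this stays below the leading term `A² s³ r / 3` (`curvesOfDegreeLE_three`,
`sum_bound`).

Without complex multiplication the entries are integers. Dividing by their gcd gives a primitive
vector `v` with `deg S = ∑ m i * v i²`, and it remains to count integral points of a box
(`countCurves_le_of_not_hasCM`). -/

/-! ### Period lattices and endomorphisms of `E`. -/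

theorem mem_lattice {τ : ℍ} {z : ℂ} : z ∈ lattice τ ↔ ∃ a b : ℤ, z = a + b * (τ : ℂ) := by
  rw [lattice, AddSubgroup.mem_closure_pair]
  constructor
  · rintro ⟨a, b, rfl⟩
    exact ⟨a, b, by simp⟩
  · rintro ⟨a, b, rfl⟩
    exact ⟨a, b, by simp⟩

theorem one_mem_lattice (τ : ℍ) : (1 : ℂ) ∈ lattice τ := mem_lattice.2 ⟨1, 0, by simp⟩

theorem coe_mem_lattice (τ : ℍ) : (τ : ℂ) ∈ lattice τ := mem_lattice.2 ⟨0, 1, by simp⟩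

theorem mem_periods {τ : ℍ} {g : ℕ} {z : Fin g → ℂ} :
    z ∈ periods τ g ↔ ∀ i, z i ∈ lattice τ := by
  rw [periods, AddMonoidHom.mem_ker, funext_iff]
  refine forall_congr' fun i => ?_
  exact QuotientAddGroup.eq_zero_iff (z i)

theorem real_add_mul_eq_zero {τ : ℍ} {a b : ℝ} (h : (a : ℂ) + b * (τ : ℂ) = 0) :
    a = 0 ∧ b = 0 := by
  have h1 := congrArg Complex.im h
  have h2 := congrArg Complex.re h
  have := τ.im_pos
  simp at h1 h2
  have hb : b = 0 := h1.resolve_right this.ne'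
  subst hb
  simpa using h2

theorem int_add_mul_inj {τ : ℍ} {a b c d : ℤ}
    (h : (a : ℂ) + b * (τ : ℂ) = c + d * (τ : ℂ)) : a = c ∧ b = d := by
  have := real_add_mul_eq_zero (τ := τ) (a := a - c) (b := b - d)
    (by push_cast; linear_combination h)
  exact ⟨by exact_mod_cast sub_eq_zero.1 this.1, by exact_mod_cast sub_eq_zero.1 this.2⟩

/-- The endomorphism ring of `E`, as the set of complex numbers which preserve the lattice. -/
def multipliers (τ : ℍ) : Set ℂ := {z | ∀ x ∈ lattice τ, z * x ∈ lattice τ}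

theorem mem_multipliers {τ : ℍ} {z : ℂ} :
    z ∈ multipliers τ ↔ z ∈ lattice τ ∧ z * τ ∈ lattice τ := by
  constructor
  · intro h
    exact ⟨by simpa using h 1 (one_mem_lattice τ), h _ (coe_mem_lattice τ)⟩
  · rintro ⟨h1, h2⟩ x hx
    obtain ⟨a, b, rfl⟩ := mem_lattice.1 hx
    have : z * (a + b * (τ : ℂ)) = a • z + b • (z * τ) := by simp; ring
    rw [this]
    exact add_mem (zsmul_mem h1 _) (zsmul_mem h2 _)

theorem lattice_countable (τ : ℍ) : (lattice τ : Set ℂ).Countable := by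
  refine (Set.countable_range fun p : ℤ × ℤ => (p.1 : ℂ) + p.2 * (τ : ℂ)).mono ?_
  intro z hz
  obtain ⟨a, b, rfl⟩ := mem_lattice.1 hz
  exact ⟨(a, b), rfl⟩

theorem periods_countable (τ : ℍ) (g : ℕ) : (periods τ g : Set (Fin g → ℂ)).Countable := by
  have h : (Set.univ.pi fun _ : Fin g => (lattice τ : Set ℂ)).Countable :=
    Set.countable_univ_pi fun _ => lattice_countable τ
  refine h.mono ?_
  intro z hz i _
  exact mem_periods.1 hz i

/-- Makes subgroups of the periods finite `ℤ`-modules, so that rank two provides an actual basis. -/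
instance periods_finite (τ : ℍ) (g : ℕ) : Module.Finite ℤ (periods τ g) := by
  let f : (Fin g → ℤ × ℤ) →+ (Fin g → ℂ) :=
    { toFun := fun c i => (c i).1 + (c i).2 * (τ : ℂ)
      map_zero' := by ext; simp
      map_add' := fun c d => by ext; simp; ring }
  let F : (Fin g → ℤ × ℤ) →+ periods τ g :=
    f.codRestrict (periods τ g) fun c => mem_periods.2 fun i => mem_lattice.2 ⟨_, _, rfl⟩
  refine Module.Finite.of_surjective F.toIntLinearMap ?_
  rintro ⟨z, hz⟩
  choose a b hab using fun i => mem_lattice.1 (mem_periods.1 hz i)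
  exact ⟨fun i => (a i, b i), Subtype.ext (funext fun i => (hab i).symm)⟩

/-! ### Subtori, their homology and their bases. -/

/-- The image in `E^g` of a complex subspace of `ℂ^g`. -/
def subtorus (τ : ℍ) {g : ℕ} (L : Submodule ℂ (Fin g → ℂ)) : AddSubgroup (Fin g → Curve τ) :=
  L.toAddSubgroup.map (cover τ g)

/-- A countability argument: if the loop of `l` runs in the subtorus but `l ∉ L`, then each real `x`
needs its own period `q` with `x • l - q ∈ L`. This injects `ℝ` into the countable group of periods.
-/
theorem homology_subtorus (τ : ℍ) {g : ℕ} (L : Submodule ℂ (Fin g → ℂ)) :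
    homology τ g (subtorus τ L) = L.toAddSubgroup ⊓ periods τ g := by
  ext l
  constructor
  · rintro ⟨hl, hS⟩
    refine ⟨?_, hl⟩
    by_contra hL
    have key : ∀ x : ℝ, ∃ q ∈ periods τ g, x • l - q ∈ L := by
      intro x
      obtain ⟨y, hy, hxy⟩ := hS x
      refine ⟨x • l - y, ?_, by simpa using hy⟩
      rw [periods, AddMonoidHom.mem_ker, map_sub, hxy, sub_self]
    choose q hq hqL using key
    have hinj : Function.Injective q := by
      intro x y hxy
      by_contra hne
      have h1 := L.sub_mem (hqL x) (hqL y)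
      rw [hxy] at h1
      have h2 : ((x - y : ℝ) : ℂ) • l ∈ L := by
        convert h1 using 1
        ext i
        simp
        ring
      have h3 : ((x - y : ℝ) : ℂ) ≠ 0 := by
        exact_mod_cast sub_ne_zero.2 hne
      exact hL ((L.smul_mem_iff h3).1 h2)
    have hc : (Set.univ : Set ℝ).Countable :=
      Set.MapsTo.countable_of_injOn (f := q) (fun x _ => hq x) hinj.injOn (periods_countable τ g)
    exact Cardinal.not_countable_real hc
  · rintro ⟨hL, hl⟩
    refine ⟨hl, fun x => ⟨x • l, ?_, rfl⟩⟩
    have : x • l = (x : ℂ) • l := by ext; simp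
    rw [this]
    exact L.smul_mem _ hL

/-- A generating pair of a rank two subgroup of the periods, which is independent. -/
theorem exists_closure_pair {τ : ℍ} {g : ℕ} {H : AddSubgroup (Fin g → ℂ)} (hH : H ≤ periods τ g)
    (h2 : Module.finrank ℤ H = 2) :
    ∃ x y : Fin g → ℂ, AddSubgroup.closure {x, y} = H ∧
      ∀ a b : ℤ, a • x + b • y = 0 → a = 0 ∧ b = 0 := by
  have : Module.Finite ℤ H :=
    Module.Finite.of_injective (AddSubgroup.inclusion hH).toIntLinearMap
      (AddSubgroup.inclusion_injective hH)
  let B := Module.finBasisOfFinrankEq ℤ H h2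
  refine ⟨B 0, B 1, ?_, ?_⟩
  · apply le_antisymm
    · rw [AddSubgroup.closure_le]
      rintro z (rfl | rfl)
      · exact (B 0).2
      · exact (B 1).2
    · intro z hz
      rw [AddSubgroup.mem_closure_pair]
      have := B.sum_repr ⟨z, hz⟩
      rw [Fin.sum_univ_two] at this
      exact ⟨_, _, congrArg Subtype.val this⟩
  · intro a b hab
    have h := Fintype.linearIndependent_iff.1 B.linearIndependent ![a, b]
      (by rw [Fin.sum_univ_two]; exact Subtype.ext hab)
    exact ⟨h 0, h 1⟩

/-! ### From curves to vectors of endomorphisms. -/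

theorem polarization_smul_smul (τ : ℍ) {g : ℕ} (m : Fin g → ℕ) (a b : ℂ) (v : Fin g → ℂ) :
    polarization τ m (a • v) (b • v)
      = (a * (starRingEnd ℂ) b).im / τ.im * ∑ i, (m i : ℝ) * Complex.normSq (v i) := by
  simp only [polarization, hermitianForm, Complex.im_sum, Finset.mul_sum]
  refine Finset.sum_congr rfl fun i _ => ?_
  simp only [← Complex.ofReal_natCast, Complex.im_ofReal_mul, Complex.div_ofReal_im]
  simp only [Pi.smul_apply, smul_eq_mul, map_mul, Complex.mul_im, Complex.mul_re, Complex.conj_re,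
    Complex.conj_im, Complex.normSq_apply]
  ring

theorem eq_zero_of_mem_span {g : ℕ} {l z : Fin g → ℂ} {j : Fin g} (hj : l j ≠ 0)
    (hz : z ∈ Submodule.span ℂ {l}) (h0 : z j = 0) : z = 0 := by
  obtain ⟨c, rfl⟩ := Submodule.mem_span_singleton.1 hz
  have : c = 0 := by simpa [hj] using h0
  simp [this]

/-- The determinant `k = a * d - b * c` is the index of the `j`-th projection of `H₁(S, ℤ)` in the
lattice. By Cramer's rule `d • x - b • y` and `a • y - c • x` have `j`-th entries `k` and `k * τ`;
lying on one line, they are `α` and `τ • α`. Both are periods, which says that the entries of `α`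
are multipliers. -/
theorem exists_multipliers_of_pos {τ : ℍ} {g : ℕ} (m : Fin g → ℕ) {l x y : Fin g → ℂ}
    (hxy : AddSubgroup.closure {x, y}
      = (Submodule.span ℂ {l}).toAddSubgroup ⊓ periods τ g)
    {j : Fin g} (hj : l j ≠ 0) {a b c d : ℤ} (hx : x j = a + b * (τ : ℂ))
    (hy : y j = c + d * (τ : ℂ)) (hpos : 0 < a * d - b * c) :
    ∃ (k : ℕ) (α : Fin g → ℂ), 0 < k ∧ (∀ i, α i ∈ multipliers τ) ∧ α j = k ∧
      (∀ i, α i = 0 ↔ l i = 0) ∧ subtorus τ (Submodule.span ℂ {l}) =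
        subtorus τ (Submodule.span ℂ {α}) ∧
      k * degree τ m (subtorus τ (Submodule.span ℂ {l}))
        = ∑ i, (m i : ℝ) * Complex.normSq (α i) := by
  obtain ⟨k, hk⟩ := Int.eq_ofNat_of_zero_le hpos.le
  have hk0 : 0 < k := by exact_mod_cast hk ▸ hpos
  have hkC : ((k : ℕ) : ℂ) = a * d - b * c := by
    have := congrArg (Int.cast : ℤ → ℂ) hk
    push_cast at this
    exact this.symm
  have hk0' : (k : ℂ) ≠ 0 := by exact_mod_cast hk0.ne'
  have hxm : x ∈ (Submodule.span ℂ {l}).toAddSubgroup ⊓ periods τ g :=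
    hxy ▸ AddSubgroup.subset_closure (by simp)
  have hym : y ∈ (Submodule.span ℂ {l}).toAddSubgroup ⊓ periods τ g :=
    hxy ▸ AddSubgroup.subset_closure (by simp)
  obtain ⟨p, hp⟩ := Submodule.mem_span_singleton.1 hxm.1
  obtain ⟨q, hq⟩ := Submodule.mem_span_singleton.1 hym.1
  have hpj : p * l j = a + b * (τ : ℂ) := by rw [← hx, ← hp]; rfl
  have hqj : q * l j = c + d * (τ : ℂ) := by rw [← hy, ← hq]; rfl
  have hxP : x ∈ periods τ g := hxm.2
  have hyP : y ∈ periods τ g := hym.2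
  have hxi : ∀ i, x i = p * l i := fun i => by rw [← hp]; rfl
  have hyi : ∀ i, y i = q * l i := fun i => by rw [← hq]; rfl
  have hα1 : (k / l j : ℂ) • l = d • x - b • y := by
    ext i
    simp only [Pi.smul_apply, Pi.sub_apply, hxi, hyi]
    simp only [smul_eq_mul, zsmul_eq_mul]
    field_simp
    rw [hkC]
    linear_combination (-(d : ℂ) * hpj + b * hqj) * l i
  have hα2 : ∀ i, ((k / l j : ℂ) • l) i * τ = (a • y - c • x) i := by
    intro i
    simp only [Pi.smul_apply, Pi.sub_apply, hxi, hyi]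
    simp only [smul_eq_mul, zsmul_eq_mul]
    field_simp
    rw [hkC]
    linear_combination ((c : ℂ) * hpj - a * hqj) * l i
  have hx' : x = ((a + b * (τ : ℂ)) / k) • ((k / l j : ℂ) • l) := by
    rw [smul_smul, ← hp, ← hpj]
    congr 1
    field_simp
  have hy' : y = ((c + d * (τ : ℂ)) / k) • ((k / l j : ℂ) • l) := by
    rw [smul_smul, ← hq, ← hqj]
    congr 1
    field_simp
  refine ⟨k, (k / l j : ℂ) • l, hk0, fun i => mem_multipliers.2 ⟨?_, ?_⟩, ?_, fun i => ?_, ?_, ?_⟩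
  · rw [hα1]
    exact mem_periods.1 (sub_mem (zsmul_mem hxP _) (zsmul_mem hyP _)) i
  · rw [hα2]
    exact mem_periods.1 (sub_mem (zsmul_mem hyP _) (zsmul_mem hxP _)) i
  · simp [hj]
  · simp [hj, hk0.ne']
  · rw [Submodule.span_singleton_smul_eq (IsUnit.mk0 _ (div_ne_zero hk0' hj))]
  · rw [degree_eq τ m _ x y (hxy.trans (homology_subtorus τ _).symm), hx', hy',
      polarization_smul_smul, abs_mul, abs_of_nonneg (a := ∑ i, _)
        (Finset.sum_nonneg fun i _ => mul_nonneg (Nat.cast_nonneg _) (Complex.normSq_nonneg _)),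
      ← mul_assoc]
    -- The numerator contributes `b * c - a * d = -k`, the two denominators `k²`.
    have : (((a + b * (τ : ℂ)) / k) * (starRingEnd ℂ) ((c + d * (τ : ℂ)) / k)).im / τ.im
        = -(1 / k : ℝ) := by
      have h1 : ((a + b * (τ : ℂ)) / k) * (starRingEnd ℂ) ((c + d * (τ : ℂ)) / k)
          = ((a + b * (τ : ℂ)) * (starRingEnd ℂ) (c + d * (τ : ℂ))) / ((k ^ 2 : ℝ) : ℂ) := by
        rw [map_div₀, Complex.conj_natCast]
        push_cast
        field_simp
      have hkR : (k : ℝ) = a * d - b * c := by exact_mod_cast hkC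
      have hkR0 : (k : ℝ) ≠ 0 := by exact_mod_cast hk0.ne'
      have := τ.im_ne_zero
      rw [h1, Complex.div_ofReal_im]
      simp only [map_add, map_mul, map_intCast,
        Complex.mul_im, Complex.add_re, Complex.add_im, Complex.mul_re, Complex.intCast_re,
        Complex.intCast_im, Complex.conj_re, Complex.conj_im, UpperHalfPlane.coe_im,
        UpperHalfPlane.coe_re]
      field_simp
      rw [hkR]
      ring
    have hkR0 : (0 : ℝ) < k := by exact_mod_cast hk0
    rw [this, abs_neg, abs_of_pos (by positivity)]
    field_simp

/-- The `j`-th coordinate is injective on the line, so a basis of its periods has independent `j`-th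
entries and nonzero determinant. Exchanging the basis vectors makes the determinant positive. -/
theorem exists_multipliers {τ : ℍ} {g : ℕ} (m : Fin g → ℕ) {l : Fin g → ℂ}
    (h2 : Module.finrank ℤ ((Submodule.span ℂ {l}).toAddSubgroup ⊓ periods τ g :
      AddSubgroup (Fin g → ℂ)) = 2)
    {j : Fin g} (hj : l j ≠ 0) :
    ∃ (k : ℕ) (α : Fin g → ℂ), 0 < k ∧ (∀ i, α i ∈ multipliers τ) ∧ α j = k ∧
      (∀ i, α i = 0 ↔ l i = 0) ∧ subtorus τ (Submodule.span ℂ {l}) =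
        subtorus τ (Submodule.span ℂ {α}) ∧
      k * degree τ m (subtorus τ (Submodule.span ℂ {l}))
        = ∑ i, (m i : ℝ) * Complex.normSq (α i) := by
  obtain ⟨x, y, hxy, hind⟩ := exists_closure_pair inf_le_right h2
  have hxm : x ∈ (Submodule.span ℂ {l}).toAddSubgroup ⊓ periods τ g :=
    hxy ▸ AddSubgroup.subset_closure (by simp)
  have hym : y ∈ (Submodule.span ℂ {l}).toAddSubgroup ⊓ periods τ g :=
    hxy ▸ AddSubgroup.subset_closure (by simp)
  obtain ⟨a, b, hx⟩ := mem_lattice.1 (mem_periods.1 hxm.2 j)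
  obtain ⟨c, d, hy⟩ := mem_lattice.1 (mem_periods.1 hym.2 j)
  have hcomb : ∀ p q : ℤ, (p : ℂ) * x j + q * y j = 0 → p = 0 ∧ q = 0 := by
    intro p q hpq
    refine hind p q (eq_zero_of_mem_span hj ?_ (by simpa using hpq))
    exact add_mem (zsmul_mem (K := (Submodule.span ℂ {l}).toAddSubgroup) hxm.1 p)
      (zsmul_mem (K := (Submodule.span ℂ {l}).toAddSubgroup) hym.1 q)
  have hdet : a * d - b * c ≠ 0 := by
    intro h0
    have h0' : (a : ℂ) * d - b * c = 0 := by exact_mod_cast h0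
    obtain ⟨h1, h3⟩ := hcomb c (-a) (by rw [hx, hy]; push_cast; linear_combination -(τ : ℂ) * h0')
    obtain ⟨h4, h5⟩ := hcomb d (-b) (by rw [hx, hy]; push_cast; linear_combination h0')
    have ha : a = 0 := by omega
    have hb : b = 0 := by omega
    subst ha hb
    have := hcomb 1 0 (by rw [hx]; simp)
    omega
  rcases lt_or_gt_of_ne hdet with h | h
  · exact exists_multipliers_of_pos m (by rw [Set.pair_comm]; exact hxy) hj hy hx (by linarith)
  · exact exists_multipliers_of_pos m hxy hj hx hy h

/-! ### Counting integral points. -/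

theorem int_card_Icc_le {a b : ℝ} (h : a ≤ b) :
    ((Finset.Icc ⌈a⌉ ⌊b⌋).card : ℝ) ≤ b - a + 1 := by
  rw [Int.card_Icc]
  have h1 := Int.floor_le b
  have h2 := Int.le_ceil a
  rcases le_total 0 (⌊b⌋ + 1 - ⌈a⌉) with h0 | h0
  · have : (((⌊b⌋ + 1 - ⌈a⌉).toNat : ℤ) : ℝ) = ((⌊b⌋ + 1 - ⌈a⌉ : ℤ) : ℝ) := by
      rw [Int.toNat_of_nonneg h0]
    rw [Int.cast_natCast] at this
    rw [this]
    push_cast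
    linarith
  · rw [Int.toNat_of_nonpos h0]
    push_cast
    linarith

/-- Integral points of the ellipse `(x - e y)² + (f y)² ≤ R`. -/
theorem exists_finset_ellipse (e : ℝ) {f R : ℝ} (hf : 0 < f) :
    ∃ T : Finset (ℤ × ℤ), (T.card : ℝ) ≤ (2 * √R + 1) * (2 * (√R / f) + 1) ∧
      ∀ x y : ℤ, (x - e * y) ^ 2 + (f * y) ^ 2 ≤ R → (x, y) ∈ T := by
  classical
  refine ⟨(Finset.Icc ⌈-(√R / f)⌉ ⌊√R / f⌋).biUnion fun y =>
    (Finset.Icc ⌈e * y - √R⌉ ⌊e * y + √R⌋).image fun x => (x, y), ?_, fun x y h => ?_⟩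
  · have hR := Real.sqrt_nonneg R
    have hRf : 0 ≤ √R / f := by positivity
    calc _ ≤ ((∑ y ∈ Finset.Icc ⌈-(√R / f)⌉ ⌊√R / f⌋,
            ((Finset.Icc ⌈e * y - √R⌉ ⌊e * y + √R⌋).image fun x => (x, y)).card : ℕ) : ℝ) := by
            exact_mod_cast Finset.card_biUnion_le
      _ ≤ ∑ y ∈ Finset.Icc ⌈-(√R / f)⌉ ⌊√R / f⌋, (2 * √R + 1) := by
            push_cast
            refine Finset.sum_le_sum fun y _ => ?_
            calc _ ≤ ((Finset.Icc ⌈e * y - √R⌉ ⌊e * y + √R⌋).card : ℝ) := by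
                    exact_mod_cast Finset.card_image_le
              _ ≤ _ := int_card_Icc_le (by linarith)
              _ = _ := by ring
      _ = (2 * √R + 1) * ((Finset.Icc ⌈-(√R / f)⌉ ⌊√R / f⌋).card : ℝ) := by
            rw [Finset.sum_const, nsmul_eq_mul, mul_comm]
      _ ≤ _ := by
            have := int_card_Icc_le (a := -(√R / f)) (b := √R / f) (by linarith)
            gcongr
            linarith
  · have h1 := abs_le.1 (Real.abs_le_sqrt (y := R) (x := x - e * y) (by nlinarith))
    have h2 := abs_le.1 (Real.abs_le_sqrt (y := R) (x := f * y) (by nlinarith))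
    simp only [Finset.mem_biUnion, Finset.mem_image, Finset.mem_Icc]
    refine ⟨y, ⟨Int.ceil_le.2 ?_, Int.le_floor.2 ?_⟩, x, ⟨Int.ceil_le.2 ?_, Int.le_floor.2 ?_⟩, rfl⟩
    · rw [neg_le, le_div_iff₀ hf]
      linarith
    · rw [le_div_iff₀ hf]
      linarith
    · linarith
    · linarith

/-! ### The endomorphism ring in the CM case. -/

section CM

variable {τ : ℍ} {u v w : ℤ}

/-- Multiplying by `w` and comparing coordinates in the basis `1, τ` shows that `w` divides `y * u`
and `y * v`, hence `y * gcd u v`; coprimality does the rest. -/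
theorem dvd_of_mul_sq_mem_lattice (hgcd : Int.gcd (Int.gcd u v) w = 1)
    (hτ : (w : ℂ) * (τ : ℂ) ^ 2 + u * (τ : ℂ) + v = 0) {y : ℤ}
    (hy : (y : ℂ) * (τ : ℂ) ^ 2 ∈ lattice τ) : w ∣ y := by
  obtain ⟨a, b, hab⟩ := mem_lattice.1 hy
  obtain ⟨h1, h2⟩ := int_add_mul_inj (τ := τ) (a := w * a) (b := w * b) (c := -(y * v))
    (d := -(y * u)) (by push_cast; linear_combination -(w : ℂ) * hab + y * hτ)
  have hu : w ∣ y * u := ⟨-b, by linarith⟩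
  have hv : w ∣ y * v := ⟨-a, by linarith⟩
  have huv : w ∣ y * (Int.gcd u v : ℤ) := by
    rw [Int.gcd_eq_gcd_ab, mul_add, ← mul_assoc, ← mul_assoc]
    exact dvd_add (hu.mul_right _) (hv.mul_right _)
  refine IsCoprime.dvd_of_dvd_mul_right ?_ huv
  rw [Int.isCoprime_iff_gcd_eq_one, Int.gcd_comm]
  exact hgcd

/-- If `z = x + y * τ` multiplies `τ` into the lattice, so does `y * τ`, and then `w ∣ y`. -/
theorem exists_of_mem_multipliers (hgcd : Int.gcd (Int.gcd u v) w = 1)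
    (hτ : (w : ℂ) * (τ : ℂ) ^ 2 + u * (τ : ℂ) + v = 0) {z : ℂ} (hz : z ∈ multipliers τ) :
    ∃ x y : ℤ, z = x + y * (w * (τ : ℂ)) := by
  obtain ⟨h1, h2⟩ := mem_multipliers.1 hz
  obtain ⟨x, y, rfl⟩ := mem_lattice.1 h1
  have hy : (y : ℂ) * (τ : ℂ) ^ 2 ∈ lattice τ := by
    have h3 : x • (τ : ℂ) ∈ lattice τ := zsmul_mem (coe_mem_lattice τ) x
    convert sub_mem h2 h3 using 1
    rw [zsmul_eq_mul]
    ring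
  obtain ⟨k, rfl⟩ := dvd_of_mul_sq_mem_lattice hgcd hτ hy
  exact ⟨x, k, by push_cast; ring⟩

theorem im_sq_eq (hτ : (w : ℂ) * (τ : ℂ) ^ 2 + u * (τ : ℂ) + v = 0) :
    (v : ℝ) * w - (u : ℝ) ^ 2 / 4 = (w * τ.im) ^ 2 := by
  have h1 := congrArg Complex.re hτ
  have h2 := congrArg Complex.im hτ
  have := τ.im_pos
  simp [pow_two] at h1 h2
  have h3 : 2 * w * τ.re + u = 0 := by
    have : τ.im * (2 * w * τ.re + u) = 0 := by linarith
    exact (mul_eq_zero.1 this).resolve_left τ.im_ne_zero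
  have h4 : (u : ℝ) = -(2 * w * τ.re) := by linarith
  rw [h4] at h1 ⊢
  linear_combination (w : ℝ) * h1

theorem ellipseArea_eq (hw : 0 < w) (hτ : (w : ℂ) * (τ : ℂ) ^ 2 + u * (τ : ℂ) + v = 0) :
    ellipseArea u v w = Real.pi / (w * τ.im) := by
  have := τ.im_pos
  have : (0 : ℝ) < w := by exact_mod_cast hw
  rw [ellipseArea, im_sq_eq hτ, Real.sqrt_sq (by positivity)]

theorem exists_finset_multipliers (hw : 0 < w) (hgcd : Int.gcd (Int.gcd u v) w = 1)
    (hτ : (w : ℂ) * (τ : ℂ) ^ 2 + u * (τ : ℂ) + v = 0) (R : ℝ) :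
    ∃ T : Finset ℂ, (T.card : ℝ) ≤ (2 * √R + 1) * (2 * (√R / (w * τ.im)) + 1) ∧
      ∀ z ∈ multipliers τ, Complex.normSq z ≤ R → z ∈ T := by
  classical
  have := τ.im_pos
  have hwR : (0 : ℝ) < w := by exact_mod_cast hw
  obtain ⟨T, hT, hmem⟩ := exists_finset_ellipse (-(w * τ.re)) (R := R) (f := w * τ.im)
    (by positivity)
  refine ⟨T.image fun p => (p.1 : ℂ) + p.2 * (w * (τ : ℂ)), le_trans ?_ hT, fun z hz hR => ?_⟩
  · exact_mod_cast Finset.card_image_le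
  · obtain ⟨x, y, rfl⟩ := exists_of_mem_multipliers hgcd hτ hz
    refine Finset.mem_image.2 ⟨(x, y), hmem x y ?_, rfl⟩
    convert hR using 1
    simp [Complex.normSq_apply]
    ring

theorem hasCM_of_quadratic (hw : 0 < w)
    (hτ : (w : ℂ) * (τ : ℂ) ^ 2 + u * (τ : ℂ) + v = 0) : HasCM τ := by
  refine ⟨w * τ, fun k hk => ?_, (?_ : _ ∈ multipliers τ)⟩
  · have := int_add_mul_inj (τ := τ) (a := 0) (b := w) (c := k) (d := 0) (by simpa using hk)
    omega
  · refine mem_multipliers.2 ⟨mem_lattice.2 ⟨0, w, by simp⟩, mem_lattice.2 ⟨-v, -u, ?_⟩⟩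
    push_cast
    linear_combination hτ

/-- The area is `π / (w * im τ)`, and two primitive equations of `τ` have leading coefficients
dividing each other. Thus `C` and `q`, chosen from one equation, serve for all. -/
theorem ellipseArea_unique {u' v' w' : ℤ} (hw : 0 < w) (hgcd : Int.gcd (Int.gcd u v) w = 1)
    (hτ : (w : ℂ) * (τ : ℂ) ^ 2 + u * (τ : ℂ) + v = 0)
    (hw' : 0 < w') (hgcd' : Int.gcd (Int.gcd u' v') w' = 1)
    (hτ' : (w' : ℂ) * (τ : ℂ) ^ 2 + u' * (τ : ℂ) + v' = 0) :
    ellipseArea u v w = ellipseArea u' v' w' := by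
  have h1 : w ∣ w' := dvd_of_mul_sq_mem_lattice hgcd hτ
    (mem_lattice.2 ⟨-v', -u', by push_cast; linear_combination hτ'⟩)
  have h2 : w' ∣ w := dvd_of_mul_sq_mem_lattice hgcd' hτ'
    (mem_lattice.2 ⟨-v, -u, by push_cast; linear_combination hτ⟩)
  rw [ellipseArea_eq hw hτ, ellipseArea_eq hw' hτ', Int.dvd_antisymm hw.le hw'.le h1 h2]

end CM

theorem HasCM.exists_quadratic {τ : ℍ} (h : HasCM τ) :
    ∃ u v w : ℤ, 0 < w ∧ Int.gcd (Int.gcd u v) w = 1 ∧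
      (w : ℂ) * (τ : ℂ) ^ 2 + u * (τ : ℂ) + v = 0 := by
  obtain ⟨z, hz, hmul⟩ := h
  obtain ⟨h1, h2⟩ := mem_multipliers.1 (show z ∈ multipliers τ from hmul)
  obtain ⟨x, y, rfl⟩ := mem_lattice.1 h1
  obtain ⟨a, b, hab⟩ := mem_lattice.1 h2
  -- `z * τ = a + b * τ` reads `y * τ² + (x - b) * τ - a = 0`, a true quadratic equation because `z`
  -- is no integer.
  have hy : y ≠ 0 := by
    rintro rfl
    exact hz x (by simp)
  have key : ∀ u v w : ℤ, 0 < w → (w : ℂ) * (τ : ℂ) ^ 2 + u * (τ : ℂ) + v = 0 →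
      ∃ u v w : ℤ, 0 < w ∧ Int.gcd (Int.gcd u v) w = 1 ∧
        (w : ℂ) * (τ : ℂ) ^ 2 + u * (τ : ℂ) + v = 0 := by
    intro u v w hw hτ
    have hpos : 0 < Int.gcd (Int.gcd u v) w := Int.gcd_pos_of_ne_zero_right _ hw.ne'
    obtain ⟨k, hk⟩ : ∃ k, Int.gcd (Int.gcd u v) w = k := ⟨_, rfl⟩
    have hkuv : (k : ℤ) ∣ Int.gcd u v := hk ▸ Int.gcd_dvd_left _ _
    have hkw : (k : ℤ) ∣ w := hk ▸ Int.gcd_dvd_right _ _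
    rw [hk] at hpos
    obtain ⟨u', rfl⟩ := hkuv.trans (Int.gcd_dvd_left u v)
    obtain ⟨v', rfl⟩ := hkuv.trans (Int.gcd_dvd_right _ v)
    obtain ⟨w', rfl⟩ := hkw
    refine ⟨u', v', w', by nlinarith [hw, (Nat.cast_pos (α := ℤ)).2 hpos], ?_, ?_⟩
    · rw [Int.gcd_mul_left, Nat.cast_mul, Int.natAbs_natCast, Int.gcd_mul_left,
        Int.natAbs_natCast] at hk
      exact (Nat.eq_of_mul_eq_mul_left hpos (by omega))
    · have : (k : ℂ) ≠ 0 := by exact_mod_cast hpos.ne'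
      refine (mul_eq_zero.1 (?_ : (k : ℂ) * _ = 0)).resolve_left this
      push_cast at hτ
      linear_combination hτ
  rcases lt_or_gt_of_ne hy with hy | hy
  · exact key (b - x) a (-y) (by omega) (by push_cast; linear_combination -hab)
  · exact key (x - b) (-a) y hy (by push_cast; linear_combination hab)

/-! ### Normalized spanning vectors, and the count without complex multiplication. -/

theorem IsEllipticCurve.exists_span {τ : ℍ} {g : ℕ} {S : AddSubgroup (Fin g → Curve τ)}
    (hS : IsEllipticCurve τ g S) :
    ∃ l : Fin g → ℂ, l ≠ 0 ∧ S = subtorus τ (Submodule.span ℂ {l}) ∧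
      Module.finrank ℤ ((Submodule.span ℂ {l}).toAddSubgroup ⊓ periods τ g :
        AddSubgroup (Fin g → ℂ)) = 2 := by
  obtain ⟨L, h1, h2, rfl⟩ := hS
  obtain ⟨⟨l, hl⟩, hl0, hspan⟩ := finrank_eq_one_iff'.1 h1
  have hL : L = Submodule.span ℂ {l} := by
    refine le_antisymm (fun z hz => ?_) ?_
    · obtain ⟨c, hc⟩ := hspan ⟨z, hz⟩
      exact Submodule.mem_span_singleton.2 ⟨c, congrArg Subtype.val hc⟩
    · rwa [Submodule.span_singleton_le_iff_mem]
  refine ⟨l, fun h => hl0 (Subtype.ext h), ?_, ?_⟩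
  · rw [← hL]; rfl
  · rw [← hL]; exact h2

/-- An elliptic curve on which the `j`-th coordinate is not constant is spanned by a vector of
endomorphisms, normalized in the `j`-th coordinate and of controlled length. -/
theorem IsEllipticCurve.exists_multipliers {τ : ℍ} {g : ℕ} (m : Fin g → ℕ)
    {S : AddSubgroup (Fin g → Curve τ)} (hS : IsEllipticCurve τ g S) :
    ∃ l : Fin g → ℂ, l ≠ 0 ∧ ∀ j, l j ≠ 0 → ∃ (k : ℕ) (α : Fin g → ℂ), 0 < k ∧
      (∀ i, α i ∈ multipliers τ) ∧ α j = k ∧ (∀ i, α i = 0 ↔ l i = 0) ∧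
      S = subtorus τ (Submodule.span ℂ {α}) ∧
      k * degree τ m S = ∑ i, (m i : ℝ) * Complex.normSq (α i) := by
  obtain ⟨l, hl, rfl, h2⟩ := hS.exists_span
  exact ⟨l, hl, fun j hj => SelfProduct.exists_multipliers m h2 hj⟩

theorem exists_int_of_not_hasCM {τ : ℍ} (h : ¬ HasCM τ) {z : ℂ} (hz : z ∈ multipliers τ) :
    ∃ k : ℤ, z = k := by
  by_contra! h0
  exact h ⟨z, h0, hz⟩

/-- The homology and the degree of the curve spanned by a primitive integral vector. -/
theorem degree_subtorus_int {τ : ℍ} {g : ℕ} (m : Fin g → ℕ) {v e : Fin g → ℤ}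
    (hv : ∑ i, e i * v i = 1) :
    degree τ m (subtorus τ (Submodule.span ℂ {fun i => (v i : ℂ)}))
      = ∑ i, (m i : ℝ) * (v i : ℝ) ^ 2 := by
  set V : Fin g → ℂ := fun i => (v i : ℂ) with hV
  have hcl : AddSubgroup.closure {(1 : ℂ) • V, (τ : ℂ) • V}
      = homology τ g (subtorus τ (Submodule.span ℂ {V})) := by
    rw [homology_subtorus]
    apply le_antisymm
    · rw [AddSubgroup.closure_le]
      have key : ∀ c ∈ lattice τ,
          c • V ∈ (Submodule.span ℂ {V}).toAddSubgroup ⊓ periods τ g := by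
        refine fun c hc => ⟨Submodule.mem_span_singleton.2 ⟨c, rfl⟩, mem_periods.2 fun i => ?_⟩
        have : (c • V) i = v i • c := by simp [hV, mul_comm]
        rw [this]
        exact zsmul_mem hc _
      rintro z (rfl | rfl)
      · exact key _ (one_mem_lattice τ)
      · exact key _ (coe_mem_lattice τ)
    · rintro z ⟨hz, hzP⟩
      obtain ⟨c, rfl⟩ := Submodule.mem_span_singleton.1 hz
      -- The Bézout relation recovers `c` as an integral combination of the entries of `c • V`, so
      -- the periods on the line are exactly the lattice times `V`.
      have hc : c ∈ lattice τ := by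
        have h1 : ∑ i, e i • (c • V) i ∈ lattice τ :=
          sum_mem fun i _ => zsmul_mem (mem_periods.1 hzP i) _
        have h2 : ∑ i, e i • (c • V) i = c := by
          have := congrArg (Int.cast : ℤ → ℂ) hv
          push_cast at this
          calc _ = c * ∑ i, (e i : ℂ) * v i := by
                rw [Finset.mul_sum]
                refine Finset.sum_congr rfl fun i _ => ?_
                simp [hV]
                ring
            _ = c := by rw [this, mul_one]
        rwa [h2] at h1
      obtain ⟨a, b, rfl⟩ := mem_lattice.1 hc
      refine AddSubgroup.mem_closure_pair.2 ⟨a, b, ?_⟩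
      ext i
      simp
      ring
  have := τ.im_ne_zero
  rw [degree_eq τ m _ _ _ hcl, polarization_smul_smul]
  have h1 : ((1 : ℂ) * (starRingEnd ℂ) (τ : ℂ)).im / τ.im = -1 := by
    simp [this]
  have h2 : ∑ i, (m i : ℝ) * Complex.normSq (V i) = ∑ i, (m i : ℝ) * (v i : ℝ) ^ 2 :=
    Finset.sum_congr rfl fun i _ => by rw [hV, Complex.normSq_intCast, pow_two]
  rw [h1, h2, neg_one_mul, abs_neg, abs_of_nonneg (Finset.sum_nonneg fun i _ => by positivity)]

theorem IsEllipticCurve.exists_int {τ : ℍ} (h : ¬ HasCM τ) {g : ℕ} (m : Fin g → ℕ)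
    {S : AddSubgroup (Fin g → Curve τ)} (hS : IsEllipticCurve τ g S) :
    ∃ v : Fin g → ℤ, S = subtorus τ (Submodule.span ℂ {fun i => (v i : ℂ)}) ∧
      degree τ m S = ∑ i, (m i : ℝ) * (v i : ℝ) ^ 2 := by
  obtain ⟨l, hl, hα⟩ := hS.exists_multipliers m
  obtain ⟨j, hj⟩ := Function.ne_iff.1 hl
  obtain ⟨k, α, hk, hmul, hαj, -, hSα, -⟩ := hα j hj
  choose a ha using fun i => exists_int_of_not_hasCM h (hmul i)
  have haj : a j ≠ 0 := by
    rintro h0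
    rw [ha, h0] at hαj
    exact hk.ne (by exact_mod_cast hαj)
  obtain ⟨v, hv, hgcd⟩ := Finset.extract_gcd a (s := Finset.univ) ⟨j, Finset.mem_univ j⟩
  have hG : Finset.univ.gcd a ≠ 0 := by
    intro h0
    exact haj (Finset.gcd_eq_zero_iff.1 h0 j (Finset.mem_univ j))
  have hspan : S = subtorus τ (Submodule.span ℂ {fun i => (v i : ℂ)}) := by
    have : α = ((Finset.univ.gcd a : ℤ) : ℂ) • fun i => (v i : ℂ) := by
      ext i
      rw [ha, hv i (Finset.mem_univ i)]
      simp
    rw [hSα, this, Submodule.span_singleton_smul_eq (IsUnit.mk0 _ (by exact_mod_cast hG))]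
  obtain ⟨e, he⟩ := Finset.gcd_eq_sum_mul Finset.univ v
  have he' : ∑ i, e i * v i = 1 := by
    rw [← hgcd, he]
    exact Finset.sum_congr rfl fun i _ => mul_comm _ _
  exact ⟨v, hspan, by rw [hspan, degree_subtorus_int m he']⟩

theorem abs_le_sqrt_div {m t : ℕ} (hm : 0 < m) {x : ℝ} (h : m * x ^ 2 ≤ t) :
    |x| ≤ √((t : ℝ) / m) := by
  refine Real.abs_le_sqrt ?_
  rw [le_div_iff₀ (by exact_mod_cast hm)]
  linarith

theorem countCurves_le_of_not_hasCM {τ : ℍ} (h : ¬ HasCM τ) {g : ℕ} {m : Fin g → ℕ}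
    (hm : ∀ i, 0 < m i) (t : ℕ) :
    (curvesOfDegreeLE τ m t).Finite ∧
      (countCurves τ m t : ℝ) ≤ ∏ i, (2 * √((t : ℝ) / m i) + 1) := by
  classical
  let T : Finset (Fin g → ℤ) := Fintype.piFinset fun i =>
    Finset.Icc ⌈-√((t : ℝ) / m i)⌉ ⌊√((t : ℝ) / m i)⌋
  let U : Finset (AddSubgroup (Fin g → Curve τ)) :=
    T.image fun v => subtorus τ (Submodule.span ℂ {fun i => (v i : ℂ)})
  have hsub : curvesOfDegreeLE τ m t ⊆ U := by
    rintro S ⟨hS, hdeg⟩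
    obtain ⟨v, rfl, hv⟩ := hS.exists_int h m
    refine Finset.mem_coe.2 (Finset.mem_image.2 ⟨v, Fintype.mem_piFinset.2 fun i => ?_, rfl⟩)
    have h1 : (m i : ℝ) * (v i : ℝ) ^ 2 ≤ t := by
      refine le_trans ?_ (hv ▸ hdeg)
      exact Finset.single_le_sum (f := fun i => (m i : ℝ) * (v i : ℝ) ^ 2)
        (fun i _ => by positivity) (Finset.mem_univ i)
    have h2 := abs_le.1 (abs_le_sqrt_div (hm i) h1)
    exact Finset.mem_Icc.2 ⟨Int.ceil_le.2 h2.1, Int.le_floor.2 h2.2⟩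
  refine ⟨U.finite_toSet.subset hsub, ?_⟩
  calc (countCurves τ m t : ℝ) ≤ U.card := by
        rw [← Set.ncard_coe_finset]
        exact_mod_cast Set.ncard_le_ncard hsub U.finite_toSet
    _ ≤ T.card := by exact_mod_cast Finset.card_image_le
    _ = ∏ i, ((Finset.Icc ⌈-√((t : ℝ) / m i)⌉ ⌊√((t : ℝ) / m i)⌋).card : ℝ) := by
        rw [Fintype.card_piFinset]
        push_cast
        rfl
    _ ≤ _ := by
        refine Finset.prod_le_prod (fun i _ => Nat.cast_nonneg _) fun i _ => ?_
        have := Real.sqrt_nonneg ((t : ℝ) / m i)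
        refine (int_card_Icc_le (by linarith)).trans ?_
        linarith

/-! ### The count with complex multiplication. -/

/-- The curves in `E³` of bounded degree, for weights sorted by `σ`: `T` and `U` contain the
endomorphisms of degree at most `t² / (4 m_{σ 0}²)` and `t² / (4 m_{σ 1} m_{σ 2})`. -/
theorem curvesOfDegreeLE_three {τ : ℍ} {m : Fin 3 → ℕ} (hm : ∀ i, 0 < m i)
    (σ : Equiv.Perm (Fin 3)) (h01 : m (σ 0) ≤ m (σ 1)) (h12 : m (σ 1) ≤ m (σ 2)) (t : ℕ)
    {T U : Finset ℂ}
    (hT : ∀ z ∈ multipliers τ, Complex.normSq z ≤ ((t : ℝ) / m (σ 0)) ^ 2 / 4 → z ∈ T)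
    (hU : ∀ z ∈ multipliers τ, Complex.normSq z ≤ (t : ℝ) ^ 2 / (m (σ 1) * m (σ 2)) / 4 → z ∈ U) :
    (curvesOfDegreeLE τ m t).Finite ∧
      countCurves τ m t ≤ (t / m (σ 0)) * (T.card * U.card)
        + (if m (σ 2) ≤ t then (t / m (σ 0)) * T.card else 0)
        + (if m (σ 0) ≤ t then 1 else 0) := by
  classical
  -- Vectors are written in sorted coordinates; `σ.symm` restores the original order.
  let F : (Fin 3 → ℂ) → AddSubgroup (Fin 3 → Curve τ) := fun c =>
    subtorus τ (Submodule.span ℂ {c ∘ σ.symm})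
  let K := Finset.Icc 1 (t / m (σ 0))
  have hK : K.card = t / m (σ 0) := by simp [K]
  -- Three families: sorted coordinate 1 is nonzero and normalized to `k`; it vanishes and
  -- coordinate 2 is normalized; only coordinate 0 survives. The last two are empty for `t` below `m
  -- (σ 2)` and `m (σ 0)` respectively.
  let W₁ := (K ×ˢ (T ×ˢ U)).image fun c => F ![c.2.1, c.1, c.2.2]
  let W₂ : Finset (AddSubgroup (Fin 3 → Curve τ)) :=
    if m (σ 2) ≤ t then (K ×ˢ T).image fun c => F ![c.2, 0, c.1] else ∅
  let W₃ : Finset (AddSubgroup (Fin 3 → Curve τ)) :=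
    if m (σ 0) ≤ t then {F ![1, 0, 0]} else ∅
  have hsub : curvesOfDegreeLE τ m t ⊆ ((W₁ ∪ W₂ ∪ W₃ : Finset _) : Set _) := by
    rintro S ⟨hS, hdeg⟩
    obtain ⟨l, hl, hα⟩ := hS.exists_multipliers m
    have hmR : ∀ i, (0 : ℝ) < m i := fun i => by exact_mod_cast hm i
    have h01R : (m (σ 0) : ℝ) ≤ m (σ 1) := by exact_mod_cast h01
    have h12R : (m (σ 1) : ℝ) ≤ m (σ 2) := by exact_mod_cast h12
    -- the bounds which hold for any choice of the normalized coordinate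
    have bound : ∀ j, l (σ j) ≠ 0 → ∃ (k : ℕ) (α : Fin 3 → ℂ), 0 < k ∧
        (∀ i, α i ∈ multipliers τ) ∧ α j = k ∧ (∀ i, α i = 0 ↔ l (σ i) = 0) ∧ S = F α ∧
        m (σ 0) * Complex.normSq (α 0) + m (σ 1) * Complex.normSq (α 1)
          + m (σ 2) * Complex.normSq (α 2) ≤ (k * t : ℝ) := by
      intro j hj
      obtain ⟨k, α, hk, hmul, hαj, h0, hSα, hsum⟩ := hα (σ j) hj
      refine ⟨k, α ∘ σ, hk, fun i => hmul _, hαj, fun i => h0 _, ?_, ?_⟩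
      · simp only [F, Function.comp_assoc, Equiv.self_comp_symm, Function.comp_id]
        exact hSα
      · rw [← Equiv.sum_comp σ, Fin.sum_univ_three] at hsum
        simp only [Function.comp_apply]
        rw [← hsum]
        gcongr
    have kle : ∀ {k : ℕ} {j : Fin 3}, 0 < k → (m (σ j) * (k : ℝ) ^ 2 ≤ k * t) →
        m (σ j) * k ≤ t := by
      intro k j hk h
      have hkR : (0 : ℝ) < k := by exact_mod_cast hk
      have : (m (σ j) * k : ℝ) ≤ t := by nlinarith
      exact_mod_cast this
    have nn := fun z => Complex.normSq_nonneg z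
    have hle : ∀ j, m (σ 0) ≤ m (σ j) := by
      intro j
      fin_cases j
      exacts [le_rfl, h01, h01.trans h12]
    have memK : ∀ {k : ℕ} {j : Fin 3}, 0 < k → m (σ j) * k ≤ t → k ∈ K := by
      intro k j hk h
      refine Finset.mem_Icc.2 ⟨hk, (Nat.le_div_iff_mul_le (hm _)).2 ?_⟩
      calc k * m (σ 0) ≤ k * m (σ j) := Nat.mul_le_mul_left _ (hle j)
        _ ≤ t := by rwa [mul_comm]
    have memT : ∀ {k : ℕ} {j : Fin 3} {z : ℂ}, z ∈ multipliers τ →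
        m (σ 0) * Complex.normSq z + m (σ j) * (k : ℝ) ^ 2 ≤ k * t → z ∈ T := by
      intro k j z hz h
      refine hT z hz ?_
      have h0 := hmR (σ 0)
      have hj : (m (σ 0) : ℝ) ≤ m (σ j) := by exact_mod_cast hle j
      rw [div_pow, div_div, le_div_iff₀ (by positivity)]
      have : m (σ 0) * Complex.normSq z + m (σ 0) * (k : ℝ) ^ 2 ≤ k * t := by
        nlinarith [sq_nonneg (k : ℝ)]
      -- Completing the square: `4 * M * (k * t - M * k²) = t² - (t - 2 * M * k)²` with `M = m (σ
      -- 0)`.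
      nlinarith [sq_nonneg ((t : ℝ) - 2 * m (σ 0) * k)]
    rw [Finset.coe_union, Finset.coe_union]
    by_cases h1 : l (σ 1) = 0
    · by_cases h2 : l (σ 2) = 0
      · right
        have h0 : l (σ 0) ≠ 0 := by
          intro h0
          apply hl
          ext i
          obtain ⟨i, rfl⟩ := σ.surjective i
          fin_cases i
          exacts [h0, h1, h2]
        obtain ⟨k, α, hk, hmul, hαj, hz, hSα, hsum⟩ := bound 0 h0
        have hα1 := (hz 1).2 h1
        have hα2 := (hz 2).2 h2
        have hkC : (k : ℂ) ≠ 0 := by exact_mod_cast hk.ne'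
        rw [hα1, hα2, hαj, Complex.normSq_natCast] at hsum
        have hle0 := kle (j := 0) hk (by simpa [pow_two] using hsum)
        have : m (σ 0) ≤ t := le_trans (Nat.le_mul_of_pos_right _ hk) hle0
        simp only [W₃, if_pos this, Finset.coe_singleton, Set.mem_singleton_iff]
        have hαk : α ∘ σ.symm = (k : ℂ) • ((![1, 0, 0] : Fin 3 → ℂ) ∘ σ.symm) := by
          ext i
          obtain ⟨i, rfl⟩ := σ.surjective i
          fin_cases i <;> simp [hα1, hα2, hαj]
        rw [hSα]
        simp only [F]
        rw [hαk, Submodule.span_singleton_smul_eq (IsUnit.mk0 _ hkC)]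
      · left; right
        obtain ⟨k, α, hk, hmul, hαj, hz, hSα, hsum⟩ := bound 2 h2
        have hα1 := (hz 1).2 h1
        rw [hα1, hαj, Complex.normSq_natCast, Complex.normSq_zero, mul_zero, add_zero, ← pow_two] at hsum
        have hle2 := kle (j := 2) hk (by nlinarith [nn (α 0), hmR (σ 0)])
        have : m (σ 2) ≤ t := le_trans (Nat.le_mul_of_pos_right _ hk) hle2
        simp only [W₂, if_pos this]
        refine Finset.mem_coe.2 (Finset.mem_image.2 ⟨(k, α 0), Finset.mem_product.2
          ⟨memK hk hle2, memT (hmul 0) hsum⟩, ?_⟩)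
        rw [hSα]
        congr 1
        ext i
        fin_cases i <;> simp [hα1, hαj]
    · left; left
      obtain ⟨k, α, hk, hmul, hαj, hz, hSα, hsum⟩ := bound 1 h1
      rw [hαj, Complex.normSq_natCast, ← pow_two] at hsum
      have hp0 := mul_nonneg (hmR (σ 0)).le (nn (α 0))
      have hp2 := mul_nonneg (hmR (σ 2)).le (nn (α 2))
      have hle1 := kle (j := 1) hk (by linarith)
      refine Finset.mem_coe.2 (Finset.mem_image.2 ⟨(k, α 0, α 2), Finset.mem_product.2
        ⟨memK hk hle1, Finset.mem_product.2 ⟨memT (j := 1) (hmul 0) (by linarith),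
          hU _ (hmul 2) ?_⟩⟩, ?_⟩)
      · have hm1 := hmR (σ 1)
        have hm2 := hmR (σ 2)
        rw [div_div, le_div_iff₀ (by positivity)]
        have : m (σ 2) * Complex.normSq (α 2) + m (σ 1) * (k : ℝ) ^ 2 ≤ k * t := by linarith
        nlinarith [sq_nonneg ((t : ℝ) - 2 * m (σ 1) * k)]
      · rw [hSα]
        congr 1
        ext i
        fin_cases i <;> simp [hαj]
  refine ⟨(W₁ ∪ W₂ ∪ W₃).finite_toSet.subset hsub, ?_⟩
  calc countCurves τ m t ≤ (W₁ ∪ W₂ ∪ W₃).card := by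
        rw [← Set.ncard_coe_finset]
        exact Set.ncard_le_ncard hsub (Finset.finite_toSet _)
    _ ≤ W₁.card + W₂.card + W₃.card :=
        (Finset.card_union_le _ _).trans (Nat.add_le_add_right (Finset.card_union_le _ _) _)
    _ ≤ _ := by
        refine Nat.add_le_add (Nat.add_le_add ?_ ?_) ?_
        · rw [← hK, ← Finset.card_product, ← Finset.card_product]
          exact Finset.card_image_le
        · simp only [W₂]
          split_ifs
          · rw [← hK, ← Finset.card_product]
            exact Finset.card_image_le
          · simp
        · simp only [W₃]
          split_ifs <;> simp

/-- The bounds for the numbers of endomorphisms combine to the bound for the number of curves. -/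
theorem sum_bound {A B s r k P Q δ ε : ℝ} (hA : 0 ≤ A) (hB : B = 2 + 2 * A / Real.pi)
    (hs : 0 ≤ s) (hr : 0 ≤ r) (hk0 : 0 ≤ k) (hk : k ≤ s)
    (hP0 : 0 ≤ P) (hP : P ≤ A * s ^ 2 / Real.pi + B * s / 2 + 1)
    (hQ : Q ≤ A * r / Real.pi + B * √r / 2 + 1)
    (hδ : δ = 0 ∨ δ = 1 ∧ 1 ≤ r) (hε : ε = 0 ∨ ε = 1 ∧ 1 ≤ s) :
    k * (P * Q) + δ * (k * P) + ε ≤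
      A * s ^ 3 / 3 * (A * r) + (A * s ^ 3 / 3 * (B * √r + 1)
        + 2 * (Real.pi * B * s ^ 2 / 8 + 2 * s) * (A * r + B * √r + 1)) := by
  have hpi := Real.pi_gt_three
  have hB2 : 2 ≤ B := by
    rw [hB]
    have : 0 ≤ 2 * A / Real.pi := by positivity
    linarith
  set Y := A * r + B * √r + 1 with hY
  have hsr := Real.sqrt_nonneg r
  have hY1 : 1 ≤ Y := by
    have : 0 ≤ B * √r := by positivity
    have : 0 ≤ A * r := by positivity
    linarith
  have hAr : A * r / Real.pi ≤ A * r := div_le_self (by positivity) (by linarith)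
  -- The bound for `Q` uses only half of `B * √r`; the other half is at least `1` when `r ≥ 1`,
  -- which pays for `δ`.
  have hQδ : Q + δ ≤ Y := by
    have hBr : 0 ≤ B * √r := by positivity
    rcases hδ with rfl | ⟨rfl, h1⟩
    · linarith
    · have : 1 ≤ √r := Real.one_le_sqrt.2 h1
      have : 2 ≤ B * √r := by nlinarith
      linarith
  have hεs : ε ≤ s * Y := by
    rcases hε with rfl | ⟨rfl, h1⟩
    · positivity
    · nlinarith
  have hPs : k * P ≤ A * s ^ 3 / 3 + Real.pi * B * s ^ 2 / 4 + s := by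
    have h1 : A * s ^ 2 / Real.pi ≤ A * s ^ 2 / 3 := by gcongr
    have h2 : B * s / 2 ≤ Real.pi * B * s / 4 := by
      have : 0 ≤ B * s := by positivity
      nlinarith
    calc k * P ≤ s * (A * s ^ 2 / 3 + Real.pi * B * s / 4 + 1) :=
          mul_le_mul hk (by linarith) hP0 hs
      _ = _ := by ring
  calc k * (P * Q) + δ * (k * P) + ε = k * P * (Q + δ) + ε := by ring
    _ ≤ k * P * Y + s * Y := by gcongr
    _ ≤ (A * s ^ 3 / 3 + Real.pi * B * s ^ 2 / 4 + s) * Y + s * Y := by gcongr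
    -- The stated remainder contains `4 * s * Y`, of which only half is needed.
    _ ≤ (A * s ^ 3 / 3 + Real.pi * B * s ^ 2 / 4 + s) * Y + s * Y + 2 * s * Y := by
        have : 0 ≤ 2 * s * Y := by positivity
        linarith
    _ = _ := by rw [hY]; ring

/-- The count for weights sorted by `σ`. -/
theorem countCurves_le_of_sorted {τ : ℍ} {u v w : ℤ} (hw : 0 < w)
    (hgcd : Int.gcd (Int.gcd u v) w = 1)
    (hτ : (w : ℂ) * (τ : ℂ) ^ 2 + u * (τ : ℂ) + v = 0) {m : Fin 3 → ℕ} (hm : ∀ i, 0 < m i)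
    (σ : Equiv.Perm (Fin 3)) (h01 : m (σ 0) ≤ m (σ 1)) (h12 : m (σ 1) ≤ m (σ 2)) (t : ℕ)
    {A B s r : ℝ} (hA : A = ellipseArea u v w) (hB : B = 2 + 2 * A / Real.pi)
    (hs : s = t / m (σ 0)) (hr : r = (t : ℝ) ^ 2 / (m (σ 1) * m (σ 2))) :
    (curvesOfDegreeLE τ m t).Finite ∧
      (countCurves τ m t : ℝ) ≤ A * s ^ 3 / 3 * (A * r) + (A * s ^ 3 / 3 * (B * √r + 1)
        + 2 * (Real.pi * B * s ^ 2 / 8 + 2 * s) * (A * r + B * √r + 1)) := by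
  have him := τ.im_pos
  have hwR : (0 : ℝ) < w := by exact_mod_cast hw
  have hmR : ∀ i, (0 : ℝ) < m i := fun i => by exact_mod_cast hm i
  have hm0 := hmR (σ 0)
  have hm1 := hmR (σ 1)
  have hm2 := hmR (σ 2)
  have h01R : (m (σ 0) : ℝ) ≤ m (σ 1) := by exact_mod_cast h01
  have h12R : (m (σ 1) : ℝ) ≤ m (σ 2) := by exact_mod_cast h12
  rw [ellipseArea_eq hw hτ] at hA
  have hpi := Real.pi_pos
  have hA0 : 0 ≤ A := by rw [hA]; positivity
  have hs0 : 0 ≤ s := by rw [hs]; positivity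
  have hr0 : 0 ≤ r := by rw [hr]; positivity
  -- the elementary bound for the number of endomorphisms of degree at most `x² / 4`
  have bd : ∀ x : ℝ, (x + 1) * (2 * (x / 2 / (w * τ.im)) + 1)
      = A * x ^ 2 / Real.pi + B * x / 2 + 1 := by
    intro x
    rw [hB, hA]
    field_simp
    ring
  have hsqrt : ∀ x : ℝ, 0 ≤ x → √(x / 4) = √x / 2 := by
    intro x hx
    rw [Real.sqrt_div hx, show (4 : ℝ) = 2 ^ 2 by norm_num, Real.sqrt_sq (by norm_num)]
  obtain ⟨T, hTc, hT⟩ := exists_finset_multipliers hw hgcd hτ (s ^ 2 / 4)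
  obtain ⟨U, hUc, hU⟩ := exists_finset_multipliers hw hgcd hτ (r / 4)
  rw [hsqrt _ (sq_nonneg s), Real.sqrt_sq hs0, mul_div_cancel₀ _ (two_ne_zero), bd] at hTc
  rw [hsqrt _ hr0, mul_div_cancel₀ _ (two_ne_zero), bd, Real.sq_sqrt hr0] at hUc
  obtain ⟨hfin, hle⟩ := curvesOfDegreeLE_three hm σ h01 h12 t (T := T) (U := U)
    (by rw [← hs]; exact hT) (by rw [← hr]; exact hU)
  refine ⟨hfin, ?_⟩
  have hle' : (countCurves τ m t : ℝ) ≤ (t / m (σ 0) : ℕ) * (T.card * U.card)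
      + (if m (σ 2) ≤ t then 1 else 0) * ((t / m (σ 0) : ℕ) * T.card)
      + (if m (σ 0) ≤ t then 1 else 0) := by
    refine (Nat.cast_le.2 hle).trans (le_of_eq ?_)
    push_cast
    congr 2
    split_ifs <;> simp
  refine hle'.trans (sum_bound hA0 hB hs0 hr0 (Nat.cast_nonneg _) (hs ▸ Nat.cast_div_le)
    (Nat.cast_nonneg _) hTc hUc ?_ ?_)
  · split_ifs with h
    · right
      have hR : (m (σ 2) : ℝ) ≤ t := by exact_mod_cast h
      refine ⟨rfl, ?_⟩
      rw [hr, one_le_div (by positivity)]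
      nlinarith
    · exact Or.inl rfl
  · split_ifs with h
    · right
      have hR : (m (σ 0) : ℝ) ≤ t := by exact_mod_cast h
      refine ⟨rfl, ?_⟩
      rwa [hs, one_le_div hm0]
    · exact Or.inl rfl

/-- The bound depends on the weights only through their minimum and product, so sorting them costs
nothing. -/
theorem countCurves_le_of_quadratic {τ : ℍ} {u v w : ℤ} (hw : 0 < w)
    (hgcd : Int.gcd (Int.gcd u v) w = 1)
    (hτ : (w : ℂ) * (τ : ℂ) ^ 2 + u * (τ : ℂ) + v = 0) {m n p : ℕ}
    (hm : 0 < m) (hn : 0 < n) (hp : 0 < p) (t : ℕ) :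
    (curvesOfDegreeLE τ ![m, n, p] t).Finite ∧
      (countCurves τ ![m, n, p] t : ℝ) ≤
        leadingConstant (ellipseArea u v w) m n p * (t : ℝ) ^ 5
          + remainderCM (ellipseArea u v w) m n p t := by
  have hpos : ∀ i, 0 < (![m, n, p] : Fin 3 → ℕ) i := by
    intro i
    fin_cases i <;> assumption
  set f : Fin 3 → ℕ := ![m, n, p] with hf
  let σ := Tuple.sort f
  have hmono : Monotone (f ∘ σ) := Tuple.monotone_sort f
  have h01 : f (σ 0) ≤ f (σ 1) := hmono (by decide)
  have h12 : f (σ 1) ≤ f (σ 2) := hmono (by decide)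
  have hmin : f (σ 0) = min m (min n p) := by
    have hle : ∀ i, f (σ 0) ≤ f i := by
      intro i
      obtain ⟨i, rfl⟩ := σ.surjective i
      exact hmono (Fin.zero_le i)
    refine le_antisymm (le_min (hle 0) (le_min (hle 1) (hle 2))) ?_
    have : ∀ i, min m (min n p) ≤ f i := by
      intro i
      fin_cases i <;> simp [hf]
    exact this _
  have hprod : (f (σ 0) : ℝ) * f (σ 1) * f (σ 2) = m * n * p := by
    have := Equiv.prod_comp σ f
    rw [Fin.prod_univ_three, Fin.prod_univ_three] at this
    exact_mod_cast this
  have hR : ∀ i, (f i : ℝ) ≠ 0 := fun i => by exact_mod_cast (hpos i).ne'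
  obtain ⟨hfin, hle⟩ := countCurves_le_of_sorted hw hgcd hτ hpos σ h01 h12 t rfl rfl rfl rfl
  refine ⟨hfin, hle.trans (le_of_eq ?_)⟩
  have h0 := hR (σ 0)
  have h1 := hR (σ 1)
  have h2 := hR (σ 2)
  have hr : (t : ℝ) ^ 2 / (f (σ 1) * f (σ 2)) = f (σ 0) * t ^ 2 / (m * n * p) := by
    rw [← hprod]
    field_simp
  have hlead : ∀ A : ℝ, A * ((t : ℝ) / f (σ 0)) ^ 3 / 3 * (A * (f (σ 0) * t ^ 2 / (m * n * p)))
      = leadingConstant A m n p * (t : ℝ) ^ 5 := by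
    intro A
    rw [leadingConstant, ← hmin, ← hprod]
    field_simp
  rw [hr, hlead]
  simp only [remainderCM, ← hmin]

/-! ### Growth of the remainders. -/

theorem remainderCM_isBigO {A : ℝ} (hA : 0 ≤ A) (m n p : ℕ) :
    (fun t : ℕ => remainderCM A m n p t) =O[atTop] fun t : ℕ => (t : ℝ) ^ 4 := by
  have hpi := Real.pi_pos
  -- The remainder is a polynomial in `t` of degree at most four with nonnegative coefficients, so
  -- for `t ≥ 1` it is at most its value at `1` times `t⁴`.
  refine IsBigO.of_bound (remainderCM A m n p 1) ?_
  filter_upwards [eventually_ge_atTop 1] with t ht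
  have htR : (1 : ℝ) ≤ t := by exact_mod_cast ht
  set k : ℝ := ((min m (min n p) : ℕ) : ℝ) with hk
  have hk0 : 0 ≤ k := Nat.cast_nonneg _
  have hexp : ∀ t : ℕ, remainderCM A m n p t =
      A * ((1 / k) * t) ^ 3 / 3 * ((2 + 2 * A / Real.pi) * (√(k / (m * n * p)) * t) + 1)
      + 2 * (Real.pi * (2 + 2 * A / Real.pi) * ((1 / k) * t) ^ 2 / 8 + 2 * ((1 / k) * t))
        * (A * (k / (m * n * p) * t ^ 2) + (2 + 2 * A / Real.pi) * (√(k / (m * n * p)) * t)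
          + 1) := by
    intro t
    have h1 : k * (t : ℝ) ^ 2 / (m * n * p) = k / (m * n * p) * t ^ 2 := by ring
    have h2 : (t : ℝ) / k = 1 / k * t := by ring
    have h3 : √(k / (m * n * p) * (t : ℝ) ^ 2) = √(k / (m * n * p)) * t := by
      rw [Real.sqrt_mul' _ (sq_nonneg _), Real.sqrt_sq (Nat.cast_nonneg t)]
    simp only [remainderCM, ← hk]
    rw [h1, h2, h3]
  rw [hexp, hexp]
  have hB : 0 ≤ 2 + 2 * A / Real.pi := by positivity
  have hr0 : 0 ≤ k / ((m : ℝ) * n * p) := by positivity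
  have hs0 : 0 ≤ 1 / k := by positivity
  have hq0 := Real.sqrt_nonneg (k / ((m : ℝ) * n * p))
  generalize 2 + 2 * A / Real.pi = B at *
  generalize √(k / ((m : ℝ) * n * p)) = q at *
  generalize k / ((m : ℝ) * n * p) = r at *
  generalize 1 / k = s at *
  rw [Real.norm_of_nonneg (by positivity), Real.norm_of_nonneg (by positivity)]
  have e1 : B * (q * t) + 1 ≤ (B * q + 1) * t := by linarith
  have ht2 : (t : ℝ) ≤ t ^ 2 := by nlinarith
  have e2 : Real.pi * B * (s * t) ^ 2 / 8 + 2 * (s * t)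
      ≤ (Real.pi * B * s ^ 2 / 8 + 2 * s) * t ^ 2 := by
    have : 2 * (s * t) ≤ 2 * (s * (t : ℝ) ^ 2) := by gcongr
    linarith
  have e3 : A * (r * t ^ 2) + B * (q * t) + 1 ≤ (A * r + B * q + 1) * (t : ℝ) ^ 2 := by
    have : B * (q * t) ≤ B * (q * (t : ℝ) ^ 2) := by gcongr
    linarith
  calc _ ≤ A * (s * t) ^ 3 / 3 * ((B * q + 1) * t)
        + 2 * ((Real.pi * B * s ^ 2 / 8 + 2 * s) * (t : ℝ) ^ 2)
          * ((A * r + B * q + 1) * (t : ℝ) ^ 2) := by gcongr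
    _ = _ := by push_cast; ring

theorem remainderNonCM_isBigO (m n p : ℕ) :
    (fun t : ℕ => remainderNonCM m n p t) =O[atTop] fun t : ℕ => (t : ℝ) ^ 4 := by
  refine IsBigO.of_bound 27 ?_
  filter_upwards [eventually_ge_atTop 1] with t ht
  have htR : (1 : ℝ) ≤ t := by exact_mod_cast ht
  -- A crude linear bound per factor suffices: the product is at most `27 * t³`.
  have key : ∀ k : ℕ, 2 * √((t : ℝ) / k) + 1 ≤ 3 * t := by
    intro k
    have h : (t : ℝ) / k ≤ t ^ 2 := by
      refine le_trans (?_ : (t : ℝ) / k ≤ t) (by nlinarith)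
      rcases Nat.eq_zero_or_pos k with rfl | hk
      · simp
      · exact div_le_self (by linarith) (by exact_mod_cast hk)
    have := (Real.sqrt_le_sqrt h).trans_eq (Real.sqrt_sq (by linarith))
    linarith
  rw [remainderNonCM, Real.norm_of_nonneg (by positivity), Real.norm_of_nonneg (by positivity)]
  calc _ ≤ (3 * (t : ℝ)) * (3 * t) * (3 * t) := by gcongr <;> exact key _
    _ = 27 * ((t : ℝ) ^ 3 * 1) := by ring
    _ ≤ 27 * ((t : ℝ) ^ 3 * t) := by gcongr
    _ = _ := by ring

end SelfProduct

theorem proposition5p2 (τ : ℍ) (m n p : ℕ) (hm : 0 < m) (hn : 0 < n) (hp : 0 < p) :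
    ∃ (C : ℝ) (q : ℕ → ℝ),
      q =O[atTop] (fun t : ℕ => (t : ℝ) ^ 4) ∧
      (∀ t : ℕ, (SelfProduct.curvesOfDegreeLE τ ![m, n, p] t).Finite ∧
        (SelfProduct.countCurves τ ![m, n, p] t : ℝ) ≤ C * (t : ℝ) ^ 5 + q t) ∧
      (∀ u v w : ℤ, 0 < w → Int.gcd (Int.gcd u v) w = 1 →
        (w : ℂ) * (τ : ℂ) ^ 2 + u * (τ : ℂ) + v = 0 →
        C = SelfProduct.leadingConstant (SelfProduct.ellipseArea u v w) m n p ∧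
        ∀ t : ℕ, q t = SelfProduct.remainderCM (SelfProduct.ellipseArea u v w) m n p t) ∧
      (¬ SelfProduct.HasCM τ →
        C = 0 ∧ ∀ t : ℕ, q t = SelfProduct.remainderNonCM m n p t) := by
  by_cases hCM : SelfProduct.HasCM τ
  · obtain ⟨u, v, w, hw, hgcd, hτ⟩ := hCM.exists_quadratic
    refine ⟨SelfProduct.leadingConstant (SelfProduct.ellipseArea u v w) m n p,
      SelfProduct.remainderCM (SelfProduct.ellipseArea u v w) m n p,
      SelfProduct.remainderCM_isBigO (div_nonneg Real.pi_pos.le (Real.sqrt_nonneg _)) m n p,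
      fun t => SelfProduct.countCurves_le_of_quadratic hw hgcd hτ hm hn hp t, ?_,
      fun h => absurd hCM h⟩
    intro u' v' w' hw' hgcd' hτ'
    rw [SelfProduct.ellipseArea_unique hw hgcd hτ hw' hgcd' hτ']
    exact ⟨rfl, fun t => rfl⟩
  · refine ⟨0, SelfProduct.remainderNonCM m n p, SelfProduct.remainderNonCM_isBigO m n p,
      fun t => ?_, fun u v w hw _ hτ => absurd (SelfProduct.hasCM_of_quadratic hw hτ) hCM,
      fun _ => ⟨rfl, fun t => rfl⟩⟩
    have hpos : ∀ i, 0 < (![m, n, p] : Fin 3 → ℕ) i := by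
      intro i
      fin_cases i <;> assumption
    obtain ⟨hfin, hle⟩ := SelfProduct.countCurves_le_of_not_hasCM hCM hpos t
    refine ⟨hfin, hle.trans (le_of_eq ?_)⟩
    simp [Fin.prod_univ_three, SelfProduct.remainderNonCM]
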